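/- Let $k$ be an infinite field with $\operatorname{char} k\neq 2$ and let $a\in k$ be a non-square. Let $n\ge 0$ be an integer and, for $1\le i\le n$, let $b_i,c_i,d_i\in k$ with $b_i\neq 0$ and with at least one of $c_i,d_i$ non-zero. Let $L_0=k(s_i,t_i,u_i,v_i : 1\le i\le n)$ be a field extension of $k$ with $\operatorname{trdeg}_k(L_0)=2n$ such that, for $1\le i\le n$, $$s_i^2-a\,t_i^2=b_i,\qquad u_i^2-a\,v_i^2=2c_i s_i+d_i .$$ Assume moreover that for each $i$ the subfield $L_i=k(s_i,t_i,u_i,v_i)$ of $L_0$ satisfies $\operatorname{trdeg}_k(L_i)=2$. Then $L_0$ is $k$-rational if and only if it is $k$-unirational. Here a finitely generated field extension $L/k$ is called $k$-rational if it is $k$-isomorphic to the field of fractions $k(x_1,\dots,x_m)$ of a polynomial ring over $k$ in $m$ variables for some integer $m\ge 0$, and $k$-unirational if it is $k$-isomorphic to a subfield of some $k$-rational field. -/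

import Mathlib

/-- The rational function field `k(x₁, …, x_m)` in `m` variables over `k`. -/
abbrev RatFunField (k : Type*) [Field k] (m : ℕ) : Type _ :=
  FractionRing (MvPolynomial (Fin m) k)

/-- An extension `L` of `k` is `k`-rational if it is `k`-isomorphic to the quotient field of a
polynomial ring over `k` in finitely many variables. -/
def IsKRational (k L : Type*) [Field k] [Field L] [Algebra k L] : Prop :=
  ∃ m : ℕ, Nonempty (L ≃ₐ[k] RatFunField k m)

/-- An extension `L` of `k` is `k`-unirational if it is `k`-isomorphic to a subfield of some
`k`-rational field, i.e. if it admits a `k`-embedding into some `k(x₁, …, x_m)`. -/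
def IsKUnirational (k L : Type*) [Field k] [Field L] [Algebra k L] : Prop :=
  ∃ m : ℕ, Nonempty (L →ₐ[k] RatFunField k m)

/-! Only unirational ⇒ rational needs work. Clearing denominators in `k(x₁, …, x_m)` and
specializing at a point of the infinite field `k` gives each block a `k`-point `(s₀, t₀, u₀, v₀)`
with `2cs₀ + d ≠ 0`. Parametrize the conic `s² - at² = b` from this point by `y`. Then `(y² - a)(2cs
+ d)` is a quadratic in `y` with leading coefficient `α = 2cs₀ + d = u₀² - av₀²`, a nonzero norm.
Multiplicativity of norms turns the second equation into `α(U² - aV²) = αy² + …`; in terms of `U -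
y` and `V` the `y²` cancels, so `y` is rational in these two elements, which generate the block. All
blocks together need `2n` generators; as the transcendence degree is `2n`, these are algebraically
independent. -/

/-- An extension that is algebraic over the field generated by a set is algebraic over the
subalgebra generated by it. -/
theorem isAlgebraic_algebraAdjoin_of_adjoin {k L : Type*} [Field k] [Field L] [Algebra k L]
    (S : Set L) (h : Algebra.IsAlgebraic (IntermediateField.adjoin k S) L) :
    Algebra.IsAlgebraic (Algebra.adjoin k S) L := by
  open scoped IntermediateField.algebraAdjoinAdjoin in
  exact (IsFractionRing.comap_isAlgebraic_iff (A := Algebra.adjoin k S)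
    (K := IntermediateField.adjoin k S) (C := L)).2 h

/-- A field extension which is the closure, under field operations and square roots, of a single
element has transcendence degree at most one. -/
theorem trdeg_le_one_of_sqrt_closed {k L : Type*} [Field k] [Field L] [Algebra k L] (w : L)
    (h : ∀ A : IntermediateField k L, w ∈ A → (∀ x, x ^ 2 ∈ A → x ∈ A) → A = ⊤) :
    Algebra.trdeg k L ≤ 1 := by
  let E := IntermediateField.adjoin k ({w} : Set L)
  let A : IntermediateField k L := (algebraicClosure E L).restrictScalars k
  have hmem : ∀ x, x ∈ A ↔ IsAlgebraic E x := fun x ↦ by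
    rw [IntermediateField.mem_restrictScalars, mem_algebraicClosure_iff]
  have hA : A = ⊤ := by
    refine h A ?_ ?_
    · exact (algebraicClosure E L).algebraMap_mem
        ⟨w, IntermediateField.subset_adjoin k _ (Set.mem_singleton w)⟩
    · intro x hx
      rw [hmem] at hx ⊢
      exact hx.of_pow two_pos
  have hE : Algebra.IsAlgebraic E L := ⟨fun x ↦ by
    rw [← hmem, hA]; exact IntermediateField.mem_top⟩
  have hR := isAlgebraic_algebraAdjoin_of_adjoin _ hE
  simpa using Algebra.IsAlgebraic.trdeg_le_cardinalMk k ({w} : Set L)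

/-- A field generated by at most as many elements as its transcendence degree is rational. -/
theorem isKRational_of_adjoin_range_eq_top {k L : Type*} [Field k] [Field L] [Algebra k L]
    {m : ℕ} (f : Fin m → L) (hf : IntermediateField.adjoin k (Set.range f) = ⊤)
    (htr : (m : Cardinal) ≤ Algebra.trdeg k L) : IsKRational k L := by
  have hE : Algebra.IsAlgebraic (IntermediateField.adjoin k (Set.range f)) L := ⟨fun x ↦
    isAlgebraic_algebraMap
      (⟨x, hf ▸ IntermediateField.mem_top⟩ : IntermediateField.adjoin k (Set.range f))⟩
  have hR := isAlgebraic_algebraAdjoin_of_adjoin _ hE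
  have hbasis : IsTranscendenceBasis k f :=
    Algebra.IsAlgebraic.isTranscendenceBasis_of_lift_le_trdeg_of_finite k f (by simpa using htr)
  exact ⟨m, ⟨(hbasis.1.aevalEquivField.trans
    ((IntermediateField.equivOfEq hf).trans IntermediateField.topEquiv)).symm⟩⟩

/-! ### Specialization to a rational point -/

/-- A pair of norm equations solvable in a rational function field over an infinite field is
solvable in the base field, avoiding a zero of the second right-hand side. -/
theorem exists_point_of_ratFunField {k : Type*} [Field k] [Infinite k] {m : ℕ} {a b c d : k}
    {s t u v : RatFunField k m}
    (hst : s ^ 2 - algebraMap k _ a * t ^ 2 = algebraMap k _ b)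
    (huv : u ^ 2 - algebraMap k _ a * v ^ 2 =
      2 * algebraMap k _ c * s + algebraMap k _ d)
    (hne : 2 * algebraMap k _ c * s + algebraMap k _ d ≠ 0) :
    ∃ s₀ t₀ u₀ v₀ : k, s₀ ^ 2 - a * t₀ ^ 2 = b ∧ u₀ ^ 2 - a * v₀ ^ 2 = 2 * c * s₀ + d ∧
      2 * c * s₀ + d ≠ 0 := by
  classical
  let P := MvPolynomial (Fin m) k
  obtain ⟨⟨q, hq⟩, hint⟩ := IsLocalization.exist_integer_multiples_of_finset
    (nonZeroDivisors P) ({s, t, u, v} : Finset (RatFunField k m))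
  have hnum : ∀ x ∈ ({s, t, u, v} : Finset (RatFunField k m)),
      ∃ p : P, algebraMap P (RatFunField k m) p = algebraMap P _ q * x := by
    intro x hx
    obtain ⟨p, hp⟩ := hint x hx
    exact ⟨p, by rw [hp, Algebra.smul_def]⟩
  obtain ⟨ps, hs⟩ := hnum s (by simp)
  obtain ⟨pt, ht⟩ := hnum t (by simp)
  obtain ⟨pu, hu⟩ := hnum u (by simp)
  obtain ⟨pv, hv⟩ := hnum v (by simp)
  have hq0 : q ≠ 0 := nonZeroDivisors.ne_zero hq
  have hinj : Function.Injective (algebraMap P (RatFunField k m)) :=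
    IsFractionRing.injective _ _
  have hQ : algebraMap P (RatFunField k m) q ≠ 0 := by
    simpa using hinj.ne hq0
  have hC : ∀ x : k, algebraMap P (RatFunField k m) (MvPolynomial.C x) =
      algebraMap k (RatFunField k m) x := fun x ↦
    (IsScalarTower.algebraMap_apply k P (RatFunField k m) x).symm
  have e₁ : ps ^ 2 - MvPolynomial.C a * pt ^ 2 = MvPolynomial.C b * q ^ 2 := by
    apply hinj
    simp only [map_sub, map_mul, map_pow, hC, hs, ht]
    linear_combination (algebraMap P (RatFunField k m) q) ^ 2 * hst
  have e₂ : pu ^ 2 - MvPolynomial.C a * pv ^ 2 =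
      2 * MvPolynomial.C c * ps * q + MvPolynomial.C d * q ^ 2 := by
    apply hinj
    simp only [map_sub, map_add, map_mul, map_pow, map_ofNat, hC, hs, hu, hv]
    linear_combination (algebraMap P (RatFunField k m) q) ^ 2 * huv
  have e₃ : 2 * MvPolynomial.C c * ps + MvPolynomial.C d * q ≠ 0 := by
    intro h
    have h' := congrArg (algebraMap P (RatFunField k m)) h
    simp only [map_add, map_mul, map_ofNat, map_zero, hC, hs] at h'
    refine mul_ne_zero hQ hne ?_
    linear_combination h'
  -- One factor keeps the common denominator nonzero at `x`, the other the right-hand side.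
  obtain ⟨x, hx⟩ : ∃ x : Fin m → k,
      MvPolynomial.eval x (q * (2 * MvPolynomial.C c * ps + MvPolynomial.C d * q)) ≠ 0 := by
    by_contra! hcon
    exact mul_ne_zero hq0 e₃ (MvPolynomial.funext fun x ↦ by simpa using hcon x)
  have f₁ := congrArg (MvPolynomial.eval x) e₁
  have f₂ := congrArg (MvPolynomial.eval x) e₂
  simp only [map_sub, map_add, map_mul, map_pow, map_ofNat, MvPolynomial.eval_C] at f₁ f₂ hx
  obtain ⟨hqx, hx⟩ := mul_ne_zero_iff.1 hx
  refine ⟨MvPolynomial.eval x ps / MvPolynomial.eval x q,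
    MvPolynomial.eval x pt / MvPolynomial.eval x q,
    MvPolynomial.eval x pu / MvPolynomial.eval x q,
    MvPolynomial.eval x pv / MvPolynomial.eval x q, ?_, ?_, ?_⟩
  · field_simp
    linear_combination f₁
  · field_simp
    linear_combination f₂
  · intro h
    field_simp at h
    exact hx (by linear_combination h)

/-! ### Rationality of a single block -/

/-- The function field of `s² - a t² = b`, `u² - a v² = 2 c s + d` is purely transcendental as
soon as this surface has a rational point at which `2 c s + d` does not vanish. -/
theorem exists_adjoin_pair_eq_top {k L : Type*} [Field k] [Field L] [Algebra k L]
    (h2 : (2 : k) ≠ 0) {a b c d : k} (ha : a ≠ 0) (hb : b ≠ 0) {s t u v : L}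
    (hgen : IntermediateField.adjoin k ({s, t, u, v} : Set L) = ⊤)
    (htr : Algebra.trdeg k L = 2)
    (hst : s ^ 2 - algebraMap k L a * t ^ 2 = algebraMap k L b)
    (huv : u ^ 2 - algebraMap k L a * v ^ 2 = 2 * algebraMap k L c * s + algebraMap k L d)
    {s₀ t₀ u₀ v₀ : k} (hst₀ : s₀ ^ 2 - a * t₀ ^ 2 = b)
    (huv₀ : u₀ ^ 2 - a * v₀ ^ 2 = 2 * c * s₀ + d) (hne : 2 * c * s₀ + d ≠ 0) :
    ∃ f : Fin 2 → L, IntermediateField.adjoin k (Set.range f) = ⊤ := by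
  have htop : ∀ A : IntermediateField k L, s ∈ A → t ∈ A → u ∈ A → v ∈ A → A = ⊤ := by
    intro A hs ht hu hv
    rw [eq_top_iff, ← hgen, IntermediateField.adjoin_le_iff]
    rintro x (rfl | rfl | rfl | rfl) <;> assumption
  have hcontra : ∀ w : L, ¬ ∀ A : IntermediateField k L, w ∈ A → (∀ x, x ^ 2 ∈ A → x ∈ A) →
      A = ⊤ := by
    intro w h
    have := trdeg_le_one_of_sqrt_closed w h
    rw [htr] at this
    exact absurd this (by norm_num)
  have hk : ∀ (A : IntermediateField k L) (x : k), algebraMap k L x ∈ A :=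
    fun A x ↦ A.algebraMap_mem x
  have hinj : ∀ {x : k}, x ≠ 0 → algebraMap k L x ≠ 0 := fun hx ↦ by simpa using hx
  have h2' : (2 : L) ≠ 0 := by
    have := hinj h2
    rwa [map_ofNat] at this
  have ha' := hinj ha
  have hb' := hinj hb
  have hne' := hinj hne
  have hst₀' := congrArg (algebraMap k L) hst₀
  have huv₀' := congrArg (algebraMap k L) huv₀
  simp only [map_sub, map_add, map_mul, map_pow, map_ofNat] at hst₀' huv₀' hne'
  have hk₂ : ∀ A : IntermediateField k L, (2 : L) ∈ A := fun A ↦ ofNat_mem A 2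
  have hka := fun A ↦ hk A a
  have hkc := fun A ↦ hk A c
  have hkd := fun A ↦ hk A d
  have hks := fun A ↦ hk A s₀
  have hkt := fun A ↦ hk A t₀
  have hku := fun A ↦ hk A u₀
  have hkv := fun A ↦ hk A v₀
  generalize algebraMap k L a = a at *
  generalize algebraMap k L b = b at *
  generalize algebraMap k L c = c at *
  generalize algebraMap k L d = d at *
  generalize algebraMap k L s₀ = s₀ at *
  generalize algebraMap k L t₀ = t₀ at *
  generalize algebraMap k L u₀ = u₀ at *
  generalize algebraMap k L v₀ = v₀ at *
  -- Otherwise `(s, t) = ±(s₀, t₀)`, and everything is algebraic over `k(v)`.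
  have hT : t * s₀ - s * t₀ ≠ 0 := by
    intro h
    refine hcontra v fun A hv hsq ↦ ?_
    have hs2 : s ^ 2 = s₀ ^ 2 := by
      apply mul_left_cancel₀ hb'
      rw [← hst₀']
      linear_combination s₀ ^ 2 * (hst - hst₀') + a * (t * s₀ + s * t₀) * h
    have ht2 : t ^ 2 = t₀ ^ 2 := by
      apply mul_left_cancel₀ hb'
      rw [← hst₀']
      linear_combination t₀ ^ 2 * (hst - hst₀') + (t * s₀ + s * t₀) * h
    have hs : s ∈ A := hsq _ (hs2 ▸ pow_mem (hks A) 2)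
    have ht : t ∈ A := hsq _ (ht2 ▸ pow_mem (hkt A) 2)
    refine htop A hs ht (hsq _ ?_) hv
    rw [show u ^ 2 = a * v ^ 2 + (2 * c * s + d) by linear_combination huv]
    exact add_mem (mul_mem (hka A) (pow_mem hv 2))
      (add_mem (mul_mem (mul_mem (hk₂ A) (hkc A)) hs) (hkd A))
  -- Hilbert 90: with `θ² = a`, `y` is chosen so that `(s + tθ)(s₀ - t₀θ) = b(y + θ)/(y - θ)`. The
  -- base point is at `y = ∞`.
  obtain ⟨y, hy⟩ : ∃ y, y * (t * s₀ - s * t₀) = s * s₀ - a * t * t₀ + b :=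
    ⟨_, div_mul_cancel₀ _ hT⟩
  have hya : (y ^ 2 - a) * (t * s₀ - s * t₀) = 2 * b * y := by
    apply mul_right_cancel₀ hT
    linear_combination (y * (t * s₀ - s * t₀) + (s * s₀ - a * t * t₀ + b) - 2 * b) * hy
      + (s₀ ^ 2 - a * t₀ ^ 2) * hst + b * hst₀'
  have hya0 : y ^ 2 - a ≠ 0 := by
    intro h
    rw [h, zero_mul] at hya
    have hy0 : y = 0 := by simpa [h2', hb'] using hya.symm
    rw [hy0] at h
    exact ha' (by linear_combination -h)
  have hya' : (y ^ 2 + a) * (t * s₀ - s * t₀) = 2 * (s * s₀ - a * t * t₀) * y := by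
    apply mul_right_cancel₀ hT
    linear_combination (t * s₀ - s * t₀) * hya + 2 * (b - (s * s₀ - a * t * t₀)) * hy
      - 2 * (s₀ ^ 2 - a * t₀ ^ 2) * hst - 2 * b * hst₀'
  have hs : s * (y ^ 2 - a) = s₀ * (y ^ 2 + a) + 2 * a * t₀ * y := by
    apply mul_right_cancel₀ hT
    linear_combination s * hya - s₀ * hya' - 2 * y * s * hst₀'
  have ht : t * (y ^ 2 - a) = t₀ * (y ^ 2 + a) + 2 * s₀ * y := by
    apply mul_right_cancel₀ hT
    linear_combination t * hya - t₀ * hya' - 2 * y * t * hst₀'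
  set α := u₀ ^ 2 - a * v₀ ^ 2 with hα
  have hα0 : α ≠ 0 := by rwa [huv₀']
  have hkα : ∀ A : IntermediateField k L, α ∈ A := fun A ↦
    sub_mem (pow_mem (hku A) 2) (mul_mem (hka A) (pow_mem (hkv A) 2))
  -- Formally `U + Vθ = (u + vθ)(y + θ)/(u₀ + v₀θ)`, of norm `(2cs + d)(y² - a)/α`.
  obtain ⟨U, hU⟩ : ∃ U, α * U = u₀ * (u * y + a * v) - a * v₀ * (u + v * y) :=
    ⟨_, mul_div_cancel₀ _ hα0⟩
  obtain ⟨V, hV⟩ : ∃ V, α * V = u₀ * (u + v * y) - v₀ * (u * y + a * v) :=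
    ⟨_, mul_div_cancel₀ _ hα0⟩
  have hU' : u₀ * U + a * v₀ * V = u * y + a * v := by
    apply mul_left_cancel₀ hα0
    linear_combination u₀ * hU + a * v₀ * hV + (u * y + a * v) * hα
  have hV' : v₀ * U + u₀ * V = u + v * y := by
    apply mul_left_cancel₀ hα0
    linear_combination v₀ * hU + u₀ * hV + (u + v * y) * hα
  have hUV : α * (U ^ 2 - a * V ^ 2) = α * y ^ 2 + 4 * a * c * t₀ * y + a * (2 * c * s₀ - d) := by
    linear_combination (U ^ 2 - a * V ^ 2) * hα + (u₀ * U + a * v₀ * V + (u * y + a * v)) * hU'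
      - a * (v₀ * U + u₀ * V + (u + v * y)) * hV' + (y ^ 2 - a) * huv + 2 * c * hs - y ^ 2 * huv₀'
  have hmem : ∀ A : IntermediateField k L, y ∈ A → U ∈ A → V ∈ A → A = ⊤ := by
    intro A hy hU hV
    have hden : y ^ 2 - a ∈ A := sub_mem (pow_mem hy 2) (hka A)
    have hnum : y ^ 2 + a ∈ A := add_mem (pow_mem hy 2) (hka A)
    have hX : u₀ * U + a * v₀ * V ∈ A :=
      add_mem (mul_mem (hku A) hU) (mul_mem (mul_mem (hka A) (hkv A)) hV)
    have hY : v₀ * U + u₀ * V ∈ A := add_mem (mul_mem (hkv A) hU) (mul_mem (hku A) hV)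
    apply htop
    · rw [eq_div_of_mul_eq hya0 hs]
      exact div_mem (add_mem (mul_mem (hks A) hnum)
        (mul_mem (mul_mem (mul_mem (hk₂ A) (hka A)) (hkt A)) hy)) hden
    · rw [eq_div_of_mul_eq hya0 ht]
      exact div_mem (add_mem (mul_mem (hkt A) hnum)
        (mul_mem (mul_mem (hk₂ A) (hks A)) hy)) hden
    · rw [show u = (y * (u₀ * U + a * v₀ * V) - a * (v₀ * U + u₀ * V)) / (y ^ 2 - a) from
        eq_div_of_mul_eq hya0 (by linear_combination -y * hU' + a * hV')]
      exact div_mem (sub_mem (mul_mem hy hX) (mul_mem (hka A) hY)) hden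
    · rw [show v = (y * (v₀ * U + u₀ * V) - (u₀ * U + a * v₀ * V)) / (y ^ 2 - a) from
        eq_div_of_mul_eq hya0 (by linear_combination -y * hV' + hU')]
      exact div_mem (sub_mem (mul_mem hy hY) hX) hden
  have h4 : ∀ A : IntermediateField k L, (4 : L) ∈ A := fun A ↦ ofNat_mem A 4
  -- Since `U² - y² = (U - y)² + 2y(U - y)`, the relation is linear in `y` once `U - y` and `V` are
  -- given.
  have hlin : y * (2 * α * (U - y) - 4 * a * c * t₀) =
      α * a * V ^ 2 + a * (2 * c * s₀ - d) - α * (U - y) ^ 2 := by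
    linear_combination hUV
  have hconst : ∀ A : IntermediateField k L, a * (2 * c * s₀ - d) ∈ A := fun A ↦
    mul_mem (hka A) (sub_mem (mul_mem (mul_mem (hk₂ A) (hkc A)) (hks A)) (hkd A))
  have hβ : ∀ A : IntermediateField k L, 4 * a * c * t₀ ∈ A := fun A ↦
    mul_mem (mul_mem (mul_mem (h4 A) (hka A)) (hkc A)) (hkt A)
  -- If this vanished, `U - y` and `V²` would be constants, making everything algebraic over `k(y)`.
  have hD : 2 * α * (U - y) - 4 * a * c * t₀ ≠ 0 := by
    intro h
    refine hcontra y fun A hy hsq ↦ ?_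
    have hp : U - y ∈ A := by
      rw [show U - y = 4 * a * c * t₀ / (2 * α) from
        eq_div_of_mul_eq (mul_ne_zero h2' hα0) (by linear_combination h)]
      exact div_mem (hβ A) (mul_mem (hk₂ A) (hkα A))
    have hV2 : V ∈ A := by
      apply hsq
      rw [show V ^ 2 = (α * (U - y) ^ 2 - a * (2 * c * s₀ - d)) / (α * a) from
        eq_div_of_mul_eq (mul_ne_zero hα0 ha') (by linear_combination y * h - hlin)]
      exact div_mem (sub_mem (mul_mem (hkα A) (pow_mem hp 2)) (hconst A))
        (mul_mem (hkα A) (hka A))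
    exact hmem A hy (by simpa using add_mem hp hy) hV2
  refine ⟨![U - y, V], ?_⟩
  set A := IntermediateField.adjoin k (Set.range ![U - y, V])
  have hp : U - y ∈ A := IntermediateField.subset_adjoin k _ ⟨0, rfl⟩
  have hV2 : V ∈ A := IntermediateField.subset_adjoin k _ ⟨1, rfl⟩
  have hy' : y ∈ A := by
    rw [eq_div_of_mul_eq hD hlin]
    exact div_mem (sub_mem (add_mem (mul_mem (mul_mem (hkα A) (hka A)) (pow_mem hV2 2)) (hconst A))
      (mul_mem (hkα A) (pow_mem hp 2)))
      (sub_mem (mul_mem (mul_mem (hk₂ A) (hkα A)) hp) (hβ A))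
  exact hmem A hy' (by simpa using add_mem hp hy') hV2

/-- If `s² - a t² = b` and `u² - a v² = 2 c s + d` generate an extension of transcendence degree
two, then `2 c s + d` does not vanish. -/
theorem right_side_ne_zero {k L : Type*} [Field k] [Field L] [Algebra k L]
    (h2 : (2 : k) ≠ 0) {a b c d : k} (ha : a ≠ 0) (hcd : c ≠ 0 ∨ d ≠ 0) {s t u v : L}
    (hgen : IntermediateField.adjoin k ({s, t, u, v} : Set L) = ⊤)
    (htr : Algebra.trdeg k L = 2)
    (hst : s ^ 2 - algebraMap k L a * t ^ 2 = algebraMap k L b)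
    (huv : u ^ 2 - algebraMap k L a * v ^ 2 = 2 * algebraMap k L c * s + algebraMap k L d) :
    2 * algebraMap k L c * s + algebraMap k L d ≠ 0 := by
  intro h
  have hinj : ∀ {x : k}, x ≠ 0 → algebraMap k L x ≠ 0 := fun hx ↦ by simpa using hx
  have ha' := hinj ha
  by_cases hc : c = 0
  · subst hc
    exact hinj (hcd.resolve_left (by simp)) (by simpa using h)
  have h2c := hinj (mul_ne_zero h2 hc)
  have hle : Algebra.trdeg k L ≤ 1 := by
    refine trdeg_le_one_of_sqrt_closed v fun A hv hsq ↦ ?_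
    have hs : s ∈ A := by
      rw [show s = -algebraMap k L d / algebraMap k L (2 * c) from
        eq_div_of_mul_eq h2c (by rw [map_mul, map_ofNat]; linear_combination h)]
      exact div_mem (neg_mem (A.algebraMap_mem d)) (A.algebraMap_mem _)
    have ht : t ∈ A := by
      apply hsq
      rw [show t ^ 2 = (s ^ 2 - algebraMap k L b) / algebraMap k L a from
        eq_div_of_mul_eq ha' (by linear_combination -hst)]
      exact div_mem (sub_mem (pow_mem hs 2) (A.algebraMap_mem b)) (A.algebraMap_mem a)
    have hu : u ∈ A := by
      apply hsq
      rw [show u ^ 2 = algebraMap k L a * v ^ 2 by linear_combination huv + h]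
      exact mul_mem (A.algebraMap_mem a) (pow_mem hv 2)
    rw [eq_top_iff, ← hgen, IntermediateField.adjoin_le_iff]
    rintro x (rfl | rfl | rfl | rfl) <;> assumption
  rw [htr] at hle
  exact absurd hle (by norm_num)

/-! ### Assembling the blocks -/

theorem theorem2p6 {k : Type*} [Field k] [Infinite k] (hchar : ringChar k ≠ 2)
    {a : k} (ha : ¬ IsSquare a)
    {L₀ : Type*} [Field L₀] [Algebra k L₀]
    (n : ℕ) (b c d : Fin n → k)
    (hb : ∀ i, b i ≠ 0) (hcd : ∀ i, c i ≠ 0 ∨ d i ≠ 0)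
    (s t u v : Fin n → L₀)
    (hgen : IntermediateField.adjoin k
      (Set.range s ∪ Set.range t ∪ Set.range u ∪ Set.range v) = ⊤)
    (htrdeg : Algebra.trdeg k L₀ = ((2 * n : ℕ) : Cardinal))
    (hst : ∀ i, s i ^ 2 - algebraMap k L₀ a * t i ^ 2 = algebraMap k L₀ (b i))
    (huv : ∀ i, u i ^ 2 - algebraMap k L₀ a * v i ^ 2 =
      2 * algebraMap k L₀ (c i) * s i + algebraMap k L₀ (d i))
    (hblock : ∀ i,
      Algebra.trdeg k (IntermediateField.adjoin k ({s i, t i, u i, v i} : Set L₀)) = 2) :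
    IsKRational k L₀ ↔ IsKUnirational k L₀ := by
  constructor
  · rintro ⟨m, ⟨e⟩⟩
    exact ⟨m, ⟨e.toAlgHom⟩⟩
  rintro ⟨m, ⟨φ⟩⟩
  have h2 : (2 : k) ≠ 0 := Ring.two_ne_zero hchar
  have ha0 : a ≠ 0 := fun h ↦ ha (h ▸ IsSquare.zero)
  have hpair : ∀ i, ∃ f : Fin 2 → L₀, IntermediateField.adjoin k (Set.range f) =
      IntermediateField.adjoin k {s i, t i, u i, v i} := by
    intro i
    set S : Set L₀ := {s i, t i, u i, v i} with hS
    let E := IntermediateField.adjoin k S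
    have hsub : S ⊆ E := IntermediateField.subset_adjoin k S
    let s' : E := ⟨s i, hsub (by simp [hS])⟩
    let t' : E := ⟨t i, hsub (by simp [hS])⟩
    let u' : E := ⟨u i, hsub (by simp [hS])⟩
    let v' : E := ⟨v i, hsub (by simp [hS])⟩
    have hgen' : IntermediateField.adjoin k ({s', t', u', v'} : Set E) = ⊤ := by
      apply IntermediateField.lift_injective
      rw [IntermediateField.lift_adjoin, IntermediateField.lift_top]
      simp [Set.image_insert_eq, E, hS, s', t', u', v']
    have hst' : s' ^ 2 - algebraMap k E a * t' ^ 2 = algebraMap k E (b i) :=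
      Subtype.ext (hst i)
    have huv' : u' ^ 2 - algebraMap k E a * v' ^ 2 =
        2 * algebraMap k E (c i) * s' + algebraMap k E (d i) := Subtype.ext (huv i)
    have hne := right_side_ne_zero h2 ha0 (hcd i) hgen' (hblock i) hst' huv'
    let ψ : E →ₐ[k] RatFunField k m := φ.comp E.val
    have hψst := congrArg ψ hst'
    have hψuv := congrArg ψ huv'
    have hψne := (map_ne_zero ψ).2 hne
    simp only [map_sub, map_add, map_mul, map_pow, map_ofNat, AlgHom.commutes]
      at hψst hψuv hψne
    obtain ⟨s₀, t₀, u₀, v₀, h₁, h₂, h₃⟩ := exists_point_of_ratFunField hψst hψuv hψne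
    obtain ⟨f, hf⟩ := exists_adjoin_pair_eq_top h2 ha0 (hb i) hgen' (hblock i) hst' huv' h₁ h₂ h₃
    refine ⟨fun j ↦ f j, ?_⟩
    have := congrArg IntermediateField.lift hf
    rw [IntermediateField.lift_adjoin, IntermediateField.lift_top, ← Set.range_comp] at this
    exact this
  choose f hf using hpair
  let g : Fin (2 * n) → L₀ := fun j ↦
    f (finProdFinEquiv.symm j).2 (finProdFinEquiv.symm j).1
  refine isKRational_of_adjoin_range_eq_top g ?_ htrdeg.ge
  have hblocks : ∀ i, IntermediateField.adjoin k {s i, t i, u i, v i} ≤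
      IntermediateField.adjoin k (Set.range g) := by
    intro i
    rw [← hf i]
    apply IntermediateField.adjoin.mono
    rintro _ ⟨j, rfl⟩
    exact ⟨finProdFinEquiv (j, i), by simp only [g, Equiv.symm_apply_apply]⟩
  have hmem : ∀ i, ∀ x ∈ ({s i, t i, u i, v i} : Set L₀),
      x ∈ IntermediateField.adjoin k (Set.range g) := fun i x hx ↦
    hblocks i (IntermediateField.subset_adjoin k _ hx)
  rw [eq_top_iff, ← hgen, IntermediateField.adjoin_le_iff]
  rintro x (((⟨i, rfl⟩ | ⟨i, rfl⟩) | ⟨i, rfl⟩) | ⟨i, rfl⟩) <;> exact hmem i _ (by simp)
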